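/- Let the state space $\mathbf X$ and the action space $\mathbf A$ be nonempty topological Borel spaces (Borel subsets of completely metrizable separable spaces, with the subspace topology and the Borel $\sigma$-algebra), let $p(dy|x,a)$ be a stochastic kernel on $\mathbf X$ given $\mathbf X\times\mathbf A$, and let $\mathsf P_0$ be a probability measure on $\mathbf X$. A strategy $\pi=\{\pi_t\}_{t\ge1}$ is a sequence of stochastic kernels $\pi_t(da|x_0,a_1,\dots,a_{t-1},x_{t-1})$ on $\mathbf A$. Its strategic measure $\mathsf P^\pi_{\mathsf P_0}$ is the law on $\mathbf H=\mathbf X\times(\mathbf A\times\mathbf X)^\infty$ of the process $X_0,A_1,X_1,A_2,\dots$ for which $X_0$ has law $\mathsf P_0$, $A_{t+1}$ has conditional law $\pi_{t+1}(\cdot|X_0,A_1,\dots,X_t)$ given $X_0,A_1,\dots,X_t$, and $X_{t+1}$ has conditional law $p(\cdot|X_t,A_{t+1})$ given $X_0,A_1,\dots,X_t,A_{t+1}$, for all $t\ge0$. Assume that the model is semi-continuous, that is, $\mathbf A$ is compact and at least one of the following holds: (S) for each $x\in\mathbf X$ and each bounded measurable $u:\mathbf X\to\mathbb R$, the function $a\mapsto\int_{\mathbf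 X}u(y)\,p(dy|x,a)$ is continuous on $\mathbf A$; (W) for each bounded continuous $u:\mathbf X\to\mathbb R$, the function $(x,a)\mapsto\int_{\mathbf X}u(y)\,p(dy|x,a)$ is continuous on $\mathbf X\times\mathbf A$. Assume also that the model is absorbing at the state $0\in\mathbf X$ for $\mathsf P_0$, that is, $0$ is an isolated point of $\mathbf X$, $p(\{0\}|0,a)=1$ for all $a\in\mathbf A$, and $\mathsf E^\pi_{\mathsf P_0}[T_0]<\infty$ for every strategy $\pi$, where $T_0=\inf\{t\ge0: X_t=0\}$ and $\inf\emptyset=\infty$. The occupation measure of $\pi$ is the measure on $(\mathbf X\setminus\{0\})\times\mathbf A$ given by $\eta^\pi_{\mathsf P_0}(\Gamma)=\sum_{t=1}^\infty\mathsf P^\pi_{\mathsf P_0}\{(X_{t-1},A_t)\in\Gamma\}$; it is finite. Let $\mathcal P=\{\mathsf P^\pi_{\mathsf P_0}:\pi\text{ a strategy}\}$ carry the weak topology of probability measures on $\mathbf H$, and let $\mathcal D=\{\eta^\pi_{\mathsf P_0}:\pi\text{ a strategy}\}$ carry the weak topology of finite measures on $(\mathbf X\setminus\{0\})\times\mathbf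 A$ (in both cases generated by the integrals of bounded continuous functions). Then the projection mapping $O:\mathcal P\to\mathcal D$, $O(\mathsf P^\pi_{\mathsf P_0})=\eta^\pi_{\mathsf P_0}$, is continuous if and only if the model is uniformly absorbing for $\mathsf P_0$, that is, $$\lim_{n\to\infty}\ \sup_{\pi}\ \mathsf E^\pi_{\mathsf P_0}\Big[\sum_{t=n}^\infty\mathbb I\{t<T_0\}\Big]=0,$$ where the supremum is over all strategies. -/

import Mathlib

open MeasureTheory ProbabilityTheory Filter Topology
open scoped ENNReal

noncomputable section

namespace MDP

universe u v

/-- A topological Borel space: (a space homeomorphic to) a Borel subset of a completely metrizable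
separable space. -/
class TopologicalBorelSpace (X : Type u) [TopologicalSpace X] : Prop where
  exists_embedding : ∃ (Y : Type u) (_ : TopologicalSpace Y) (_ : PolishSpace Y) (f : X → Y),
    IsEmbedding f ∧ MeasurableSet[borel Y] (Set.range f)

instance TopologicalBorelSpace.secondCountableTopology (X : Type u) [TopologicalSpace X]
    [h : TopologicalBorelSpace X] : SecondCountableTopology X := by
  obtain ⟨Y, _, _, f, hf, -⟩ := h.exists_embedding
  exact hf.secondCountableTopology

instance TopologicalBorelSpace.metrizableSpace (X : Type u) [TopologicalSpace X]
    [h : TopologicalBorelSpace X] : TopologicalSpace.MetrizableSpace X := by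
  obtain ⟨Y, _, _, f, hf, -⟩ := h.exists_embedding
  exact hf.metrizableSpace

/-- The space of trajectories `x₀, a₁, x₁, a₂, …`. The pair `(x_t, a_{t+1})` is the `t`-th term of
the sequence, so that `X × (A × X)^∞` is written as `(X × A)^ℕ`. It carries the product topology and
the product σ-algebra. -/
abbrev Trajectory (X : Type u) (A : Type v) : Type (max u v) := ℕ → X × A

/-- The space of histories `x₀, a₁, x₁, …, a_t, x_t` up to time `t`, that is `(X × A)^t × X`. -/
abbrev History (X : Type u) (A : Type v) (t : ℕ) : Type (max u v) := (Fin t → X × A) × X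

/-- The history up to time `t` of a trajectory. -/
def history {X : Type u} {A : Type v} (t : ℕ) (ω : Trajectory X A) : History X A t :=
  (fun i => ω i, (ω t).1)

/-- A (randomized, history-dependent) control strategy: `kernel t` is the conditional law of the
action `a_{t+1}` given the history `x₀, a₁, x₁, …, a_t, x_t`. -/
structure Strategy (X : Type u) (A : Type v) [MeasurableSpace X] [MeasurableSpace A] where
  kernel : ∀ t : ℕ, Kernel (History X A t) A
  isMarkovKernel : ∀ t : ℕ, IsMarkovKernel (kernel t)

instance {X : Type u} {A : Type v} [MeasurableSpace X] [MeasurableSpace A] (π : Strategy X A)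
    (t : ℕ) : IsMarkovKernel (π.kernel t) := π.isMarkovKernel t

section StrategicMeasure

variable {X : Type u} {A : Type v} [MeasurableSpace X] [MeasurableSpace A]

/-- The first `t + 1` state-action pairs, together with the next state, as a history. -/
def nextHistory (t : ℕ) (q : ((_ : Finset.Iic t) → X × A) × X) : History X A (t + 1) :=
  (fun i => q.1 ⟨i, Finset.mem_Iic.2 (Nat.lt_succ_iff.1 i.2)⟩, q.2)

theorem measurable_nextHistory (t : ℕ) : Measurable (nextHistory (X := X) (A := A) t) := by
  unfold nextHistory
  fun_prop

/-- The law of `(x₀, a₁)`: `x₀` has law `P₀`, and `a₁` is chosen by the strategy. -/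
def initialLaw (P₀ : Measure X) (π : Strategy X A) : Measure (X × A) :=
  P₀ ⊗ₘ (π.kernel 0).comap (fun x : X => ((Fin.elim0 : Fin 0 → X × A), x)) (by fun_prop)

/-- The law of `(x_{t+1}, a_{t+2})` given `(x₀, a₁, …, x_t, a_{t+1})`: the next state is drawn from
`p (· | x_t, a_{t+1})`, then the action is drawn by the strategy given the resulting history. -/
def stepKernel (p : Kernel (X × A) X) (π : Strategy X A) (t : ℕ) :
    Kernel ((_ : Finset.Iic t) → X × A) (X × A) :=
  (p.comap (fun h : (_ : Finset.Iic t) → X × A => h ⟨t, Finset.mem_Iic.2 le_rfl⟩) (by fun_prop)) ⊗ₖ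
    ((π.kernel (t + 1)).comap (nextHistory t) (measurable_nextHistory t))

instance (P₀ : Measure X) [IsProbabilityMeasure P₀] (π : Strategy X A) :
    IsProbabilityMeasure (initialLaw P₀ π) := by
  unfold initialLaw; infer_instance

instance (p : Kernel (X × A) X) [IsMarkovKernel p] (π : Strategy X A) (t : ℕ) :
    IsMarkovKernel (stepKernel p π t) := by
  unfold stepKernel; infer_instance

/-- The strategic measure of the strategy `π` for the initial distribution `P₀`, given by the
Ionescu-Tulcea theorem. -/
def strategicMeasure (p : Kernel (X × A) X) [IsMarkovKernel p] (P₀ : Measure X)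
    (π : Strategy X A) : Measure (Trajectory X A) :=
  Kernel.trajMeasure (X := fun _ : ℕ => X × A) (initialLaw P₀ π) (stepKernel p π)

instance (p : Kernel (X × A) X) [IsMarkovKernel p] (P₀ : Measure X) [IsProbabilityMeasure P₀]
    (π : Strategy X A) : IsProbabilityMeasure (strategicMeasure p P₀ π) := by
  unfold strategicMeasure; infer_instance

theorem map_compProd_comap {α β γ : Type*} [MeasurableSpace α] [MeasurableSpace β]
    [MeasurableSpace γ] (μ : Measure α) [SFinite μ] (κ : Kernel β γ) [IsSFiniteKernel κ] {f : α → β}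
    (hf : Measurable f) :
    (μ ⊗ₘ κ.comap f hf).map (fun q => (f q.1, q.2)) = μ.map f ⊗ₘ κ := by
  ext s hs
  have hg : Measurable fun q : α × γ => (f q.1, q.2) := by fun_prop
  rw [Measure.map_apply hg hs, Measure.compProd_apply (hg hs), Measure.compProd_apply hs,
    lintegral_map (Kernel.measurable_kernel_prodMk_left hs) hf]
  rfl

theorem strategicMeasure_map_zero (p : Kernel (X × A) X) [IsMarkovKernel p] (P₀ : Measure X)
    [IsProbabilityMeasure P₀] (π : Strategy X A) :
    (strategicMeasure p P₀ π).map (fun ω => ω 0) = initialLaw P₀ π := by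
  have h : (strategicMeasure p P₀ π).map (Preorder.frestrictLe 0) =
      (initialLaw P₀ π).map (MeasurableEquiv.piUnique
        (fun _ : Finset.Iic 0 => X × A)).symm := by
    rw [strategicMeasure, Kernel.trajMeasure, Measure.map_comp _ _ (by fun_prop),
      Kernel.traj_map_frestrictLe, Kernel.partialTraj_self, Measure.id_comp]
  have h2 := congrArg (Measure.map (fun h : (_ : Finset.Iic 0) → X × A =>
    h ⟨0, Finset.mem_Iic.2 le_rfl⟩)) h
  rw [Measure.map_map (by fun_prop) (by fun_prop), Measure.map_map (by fun_prop) (by fun_prop)] at h2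
  exact h2.trans Measure.map_id

/-- The initial state has law `P₀`. -/
theorem strategicMeasure_initial (p : Kernel (X × A) X) [IsMarkovKernel p] (P₀ : Measure X)
    [IsProbabilityMeasure P₀] (π : Strategy X A) :
    (strategicMeasure p P₀ π).map (fun ω => (ω 0).1) = P₀ := by
  have h := congrArg (Measure.map Prod.fst) (strategicMeasure_map_zero p P₀ π)
  rw [Measure.map_map measurable_fst (measurable_pi_apply 0)] at h
  exact h.trans (Measure.fst_compProd _ _)

theorem measurable_history (t : ℕ) : Measurable (history (X := X) (A := A) t) := by
  unfold history
  fun_prop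

theorem strategicMeasure_step (p : Kernel (X × A) X) [IsMarkovKernel p] (P₀ : Measure X)
    [IsProbabilityMeasure P₀] (π : Strategy X A) (t : ℕ) :
    (strategicMeasure p P₀ π).map
        (fun ω => (Preorder.frestrictLe (π := fun _ : ℕ => X × A) t ω, ω (t + 1))) =
      (strategicMeasure p P₀ π).map (Preorder.frestrictLe t) ⊗ₘ stepKernel p π t :=
  Kernel.map_frestrictLe_trajMeasure_compProd_eq_map_trajMeasure.symm

theorem strategicMeasure_step_fst (p : Kernel (X × A) X) [IsMarkovKernel p] (P₀ : Measure X)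
    [IsProbabilityMeasure P₀] (π : Strategy X A) (t : ℕ) :
    (strategicMeasure p P₀ π).map
        (fun ω => (Preorder.frestrictLe (π := fun _ : ℕ => X × A) t ω, (ω (t + 1)).1)) =
      (strategicMeasure p P₀ π).map (Preorder.frestrictLe t) ⊗ₘ
        (p.comap (fun h : (_ : Finset.Iic t) → X × A => h ⟨t, Finset.mem_Iic.2 le_rfl⟩)
          (by fun_prop)) := by
  have h := congrArg (Measure.map (Prod.map id Prod.fst)) (strategicMeasure_step p P₀ π t)
  rw [Measure.map_map (by fun_prop) (by fun_prop), ← Measure.compProd_map measurable_fst,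
    ← Kernel.fst_eq, stepKernel, Kernel.fst_compProd] at h
  exact h

/-- The conditional law of `a_{t+1}` given the history up to time `t` is `π.kernel t`. -/
theorem strategicMeasure_action (p : Kernel (X × A) X) [IsMarkovKernel p] (P₀ : Measure X)
    [IsProbabilityMeasure P₀] (π : Strategy X A) (t : ℕ) :
    (strategicMeasure p P₀ π).map (fun ω => (history t ω, (ω t).2)) =
      (strategicMeasure p P₀ π).map (history t) ⊗ₘ π.kernel t := by
  cases t with
  | zero =>
    have hf : Measurable fun x : X => ((Fin.elim0 : Fin 0 → X × A), x) := by fun_prop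
    have h := map_compProd_comap P₀ (π.kernel 0) hf
    have h0 := strategicMeasure_map_zero p P₀ π
    have he : ∀ ω : Trajectory X A, history 0 ω = ((Fin.elim0 : Fin 0 → X × A), (ω 0).1) :=
      fun ω => Prod.ext (Subsingleton.elim _ _) rfl
    have h1 : (strategicMeasure p P₀ π).map (history 0) =
        P₀.map fun x : X => ((Fin.elim0 : Fin 0 → X × A), x) := by
      conv_rhs => rw [← strategicMeasure_initial p P₀ π]
      rw [Measure.map_map hf (by fun_prop)]
      exact congrArg (fun g => Measure.map g _) (funext he)
    rw [h1, ← h]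
    change _ = Measure.map _ (initialLaw P₀ π)
    rw [← h0, Measure.map_map (by fun_prop) (by fun_prop)]
    exact congrArg (fun g => Measure.map g _) (funext fun ω => Prod.ext (he ω) rfl)
  | succ t =>
    have h := strategicMeasure_step p P₀ π t
    have h' := congrArg (Measure.map MeasurableEquiv.prodAssoc.symm) h
    rw [Measure.map_map (by fun_prop) (by fun_prop), stepKernel, Measure.compProd_assoc,
      ← strategicMeasure_step_fst] at h'
    have h2 := congrArg (Measure.map fun q : (((_ : Finset.Iic t) → X × A) × X) × A =>
      (nextHistory t q.1, q.2)) h'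
    have hm := measurable_nextHistory (X := X) (A := A) t
    rw [map_compProd_comap _ _ hm, Measure.map_map (by fun_prop) (by fun_prop),
      Measure.map_map (by fun_prop) (by fun_prop)] at h2
    exact h2

/-- The conditional law of `x_{t+1}` given `x₀, a₁, …, x_t, a_{t+1}` is `p (· | x_t, a_{t+1})`. -/
theorem strategicMeasure_transition (p : Kernel (X × A) X) [IsMarkovKernel p] (P₀ : Measure X)
    [IsProbabilityMeasure P₀] (π : Strategy X A) (t : ℕ) :
    (strategicMeasure p P₀ π).map (fun ω => ((history t ω, (ω t).2), (ω (t + 1)).1)) =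
      (strategicMeasure p P₀ π).map (fun ω => (history t ω, (ω t).2)) ⊗ₘ
        p.comap (fun q : History X A t × A => (q.1.2, q.2)) (by fun_prop) := by
  have hf : Measurable fun h : (_ : Finset.Iic t) → X × A =>
      (((fun i : Fin t => h ⟨i, Finset.mem_Iic.2 i.2.le⟩, (h ⟨t, Finset.mem_Iic.2 le_rfl⟩).1),
        (h ⟨t, Finset.mem_Iic.2 le_rfl⟩).2) : History X A t × A) := by fun_prop
  have h := map_compProd_comap ((strategicMeasure p P₀ π).map (Preorder.frestrictLe t))
    (p.comap (fun q : History X A t × A => (q.1.2, q.2)) (by fun_prop)) hf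
  have h2 := strategicMeasure_step_fst p P₀ π t
  rw [Measure.map_map hf (by fun_prop)] at h
  refine Eq.trans ?_ h
  refine Eq.trans ?_ (congrArg (Measure.map fun q : ((_ : Finset.Iic t) → X × A) × X =>
    ((((fun i : Fin t => q.1 ⟨i, Finset.mem_Iic.2 i.2.le⟩,
      (q.1 ⟨t, Finset.mem_Iic.2 le_rfl⟩).1), (q.1 ⟨t, Finset.mem_Iic.2 le_rfl⟩).2), q.2) :
        (History X A t × A) × X)) h2)
  rw [Measure.map_map (by fun_prop) (by fun_prop)]
  rfl

end StrategicMeasure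

section Absorbing

variable {X : Type u} {A : Type v}

/-- The hitting time `T₀ = inf {t ≥ 0 : X_t = z}`, with `inf ∅ = ∞`. -/
def hittingTime (z : X) (ω : Trajectory X A) : ℕ∞ :=
  ⨅ (t : ℕ) (_ : (ω t).1 = z), (t : ℕ∞)

theorem tsum_indicator_le_hittingTime {z : X} {ω : Trajectory X A}
    (h : ∀ t, (ω t).1 = z → (ω (t + 1)).1 = z) :
    ∑' t : ℕ, {ω : Trajectory X A | (ω t).1 ≠ z}.indicator (1 : Trajectory X A → ℝ≥0∞) ω
      ≤ (hittingTime z ω : ℝ≥0∞) := by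
  unfold hittingTime
  by_cases hex : ∃ t, (ω t).1 = z
  · have hn : ∀ n, (ω n).1 = z → ∑' t : ℕ,
        {ω : Trajectory X A | (ω t).1 ≠ z}.indicator (1 : Trajectory X A → ℝ≥0∞) ω ≤ (n : ℝ≥0∞) := by
      intro n hn
      have hafter : ∀ t, n ≤ t → (ω t).1 = z := fun t ht => by
        induction t, ht using Nat.le_induction with
        | base => exact hn
        | succ t _ ih => exact h t ih
      rw [tsum_eq_sum (s := Finset.range n)]
      · calc _ ≤ ∑ _t ∈ Finset.range n, (1 : ℝ≥0∞) :=
              Finset.sum_le_sum fun t _ => Set.indicator_le_self' (by simp) ω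
          _ = n := by simp
      · intro t ht
        have := hafter t (by simpa using ht)
        simp [this]
    classical
    have hN := Nat.find_spec hex
    have heq : (⨅ (t : ℕ) (_ : (ω t).1 = z), (t : ℕ∞)) = (Nat.find hex : ℕ) := by
      apply le_antisymm
      · exact iInf₂_le (f := fun (t : ℕ) (_ : (ω t).1 = z) => (t : ℕ∞)) _ hN
      · exact le_iInf₂ fun t ht => by exact_mod_cast Nat.find_min' hex ht
    rw [heq]
    simpa using hn _ hN
  · have : (⨅ (t : ℕ) (_ : (ω t).1 = z), (t : ℕ∞)) = ⊤ := by
      simp only [not_exists] at hex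
      simp [hex]
    rw [this]; simp

variable [MeasurableSpace X] [MeasurableSpace A]

/-- The model is absorbing at `z` for the initial distribution `P₀`: the state `z` is isolated and
absorbing, and its expected hitting time is finite under every strategy. -/
structure IsAbsorbing [TopologicalSpace X] (p : Kernel (X × A) X) [IsMarkovKernel p]
    (P₀ : Measure X) (z : X) : Prop where
  isolated : IsOpen ({z} : Set X)
  absorbing : ∀ a : A, p (z, a) {z} = 1
  expectation_lt_top : ∀ π : Strategy X A,
    ∫⁻ ω, (hittingTime z ω : ℝ≥0∞) ∂(strategicMeasure p P₀ π) < ∞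

/-- The model is uniformly absorbing at `z` for `P₀`: it is absorbing, and
`sup_π E^π [∑_{t ≥ n} 1{t < T₀}] → 0` as `n → ∞`. -/
structure IsUniformlyAbsorbing [TopologicalSpace X] (p : Kernel (X × A) X) [IsMarkovKernel p]
    (P₀ : Measure X) (z : X) : Prop where
  isAbsorbing : IsAbsorbing p P₀ z
  tendsto_zero : Tendsto
    (fun n : ℕ => ⨆ π : Strategy X A,
      ∫⁻ ω, ∑' t : ℕ, (if n ≤ t ∧ (t : ℕ∞) < hittingTime z ω then (1 : ℝ≥0∞) else 0)
        ∂(strategicMeasure p P₀ π))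
    atTop (𝓝 0)

/-- The occupation measure on `(X ∖ {z}) × A` of a law `P` on trajectories: the set `Γ` gets the mass
`∑_{t ≥ 1} P ((X_{t-1}, A_t) ∈ Γ)`. -/
def occupation (z : X) (P : Measure (Trajectory X A)) : Measure ({x : X // x ≠ z} × A) :=
  Measure.sum fun t : ℕ =>
    (P.map (fun ω : Trajectory X A => ω t)).comap (fun q => ((q.1 : X), q.2))

/-- The occupation measure of the strategy `π` for the initial distribution `P₀`. -/
def occupationMeasure (p : Kernel (X × A) X) [IsMarkovKernel p] (P₀ : Measure X) (z : X)
    (π : Strategy X A) : Measure ({x : X // x ≠ z} × A) :=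
  occupation z (strategicMeasure p P₀ π)

end Absorbing

section SemiContinuous

variable {X : Type u} {A : Type v} [MeasurableSpace X] [MeasurableSpace A]
  [TopologicalSpace A]

/-- Semi-continuity (S): `A` is compact, and `∫ u(y) p(dy | x, a)` is continuous in `a` for each `x`
and each bounded measurable `u`. -/
structure SemiContinuousS (p : Kernel (X × A) X) : Prop where
  compactSpace : CompactSpace A
  continuous_integral : ∀ (x : X) (u : X → ℝ), Measurable u → (∃ C : ℝ, ∀ y, |u y| ≤ C) →
    Continuous fun a : A => ∫ y, u y ∂(p (x, a))

/-- Semi-continuity (W): `A` is compact, and `∫ u(y) p(dy | x, a)` is continuous in `(x, a)` for each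
bounded continuous `u`. -/
structure SemiContinuousW [TopologicalSpace X] (p : Kernel (X × A) X) : Prop where
  compactSpace : CompactSpace A
  continuous_integral : ∀ u : X → ℝ, Continuous u → (∃ C : ℝ, ∀ y, |u y| ≤ C) →
    Continuous fun q : X × A => ∫ y, u y ∂(p q)

/-- A semi-continuous model: semi-continuous (S) or semi-continuous (W). -/
def SemiContinuous [TopologicalSpace X] (p : Kernel (X × A) X) : Prop :=
  SemiContinuousS p ∨ SemiContinuousW p

end SemiContinuous

section Finite

variable {X : Type u} {A : Type v} [MeasurableSpace X] [MeasurableSpace A]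

theorem measurableEmbedding_inclusion {z : X} (hz : MeasurableSet ({z} : Set X)) :
    MeasurableEmbedding (fun q : {x : X // x ≠ z} × A => ((q.1 : X), q.2)) :=
  (MeasurableEmbedding.subtype_coe hz.compl).prodMap MeasurableEmbedding.id

/-- The value of an occupation measure on measurable sets. -/
theorem occupation_apply {z : X} (hz : MeasurableSet ({z} : Set X)) (P : Measure (Trajectory X A))
    {Γ : Set ({x : X // x ≠ z} × A)} (hΓ : MeasurableSet Γ) :
    occupation z P Γ =
      ∑' t : ℕ, P {ω | ∃ q ∈ Γ, ((q.1 : X), q.2) = ω t} := by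
  have he := measurableEmbedding_inclusion (A := A) hz
  rw [occupation, Measure.sum_apply _ hΓ]
  refine tsum_congr fun t => ?_
  rw [he.comap_apply, Measure.map_apply (measurable_pi_apply t) (he.measurableSet_image.2 hΓ)]
  rfl

theorem ae_absorbed {p : Kernel (X × A) X} [IsMarkovKernel p] {P₀ : Measure X}
    [IsProbabilityMeasure P₀] {z : X} (hz : MeasurableSet ({z} : Set X))
    (habs : ∀ a : A, p (z, a) {z} = 1) (π : Strategy X A) (t : ℕ) :
    ∀ᵐ ω ∂(strategicMeasure p P₀ π), (ω t).1 = z → (ω (t + 1)).1 = z := by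
  have key := Kernel.map_frestrictLe_trajMeasure_compProd_eq_map_trajMeasure
    (X := fun _ : ℕ => X × A) (μ₀ := initialLaw P₀ π) (κ := stepKernel p π) (a := t)
  set S : Set (((_ : Finset.Iic t) → X × A) × (X × A)) :=
    {q | (q.1 ⟨t, Finset.mem_Iic.2 le_rfl⟩).1 = z ∧ q.2.1 ∈ ({z} : Set X)ᶜ} with hS
  have hSm : MeasurableSet S := by
    refine MeasurableSet.inter (s₁ := {q : ((_ : Finset.Iic t) → X × A) × (X × A) |
      (q.1 ⟨t, Finset.mem_Iic.2 le_rfl⟩).1 ∈ ({z} : Set X)}) ?_ ?_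
    · exact hz.preimage (by fun_prop)
    · exact hz.compl.preimage (by fun_prop)
  have h0 : (Measure.map (Preorder.frestrictLe t) (strategicMeasure p P₀ π) ⊗ₘ stepKernel p π t) S
      = 0 := by
    rw [Measure.compProd_apply hSm]
    refine (lintegral_congr fun h => ?_).trans lintegral_zero
    by_cases hh : (h ⟨t, Finset.mem_Iic.2 le_rfl⟩).1 = z
    · have : Prod.mk h ⁻¹' S = Prod.fst ⁻¹' ({z} : Set X)ᶜ := by
        ext b; simp [hS, hh]
      rw [this, ← Measure.fst_apply hz.compl, stepKernel, Measure.fst, ← Kernel.fst_apply,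
        Kernel.fst_compProd, Kernel.comap_apply, prob_compl_eq_zero_iff hz]
      have : h ⟨t, Finset.mem_Iic.2 le_rfl⟩ = (z, (h ⟨t, Finset.mem_Iic.2 le_rfl⟩).2) := by
        rw [← hh]
      rw [this]; exact habs _
    · have : Prod.mk h ⁻¹' S = ∅ := by
        ext b; simp [hS, hh]
      rw [this, measure_empty]
  rw [ae_iff]
  have h1 := h0
  rw [strategicMeasure, key, Measure.map_apply (by fun_prop) hSm] at h1
  refine measure_mono_null (fun ω hω => ?_) h1
  simpa [hS] using hω

/-- In an absorbing model occupation measures are finite. -/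
theorem isFiniteMeasure_occupationMeasure [TopologicalSpace X] [BorelSpace X]
    {p : Kernel (X × A) X} [IsMarkovKernel p] {P₀ : Measure X} [IsProbabilityMeasure P₀] {z : X}
    (h : IsAbsorbing p P₀ z) (π : Strategy X A) :
    IsFiniteMeasure (occupationMeasure p P₀ z π) := by
  have hz : MeasurableSet ({z} : Set X) := h.isolated.measurableSet
  refine ⟨lt_of_le_of_lt ?_ (h.expectation_lt_top π)⟩
  rw [occupationMeasure, occupation_apply hz _ MeasurableSet.univ]
  have hm : ∀ t : ℕ, MeasurableSet {ω : Trajectory X A | (ω t).1 ≠ z} := fun t =>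
    hz.compl.preimage (f := fun ω : Trajectory X A => (ω t).1) (by fun_prop)
  calc _ = ∑' t : ℕ, ∫⁻ ω, {ω : Trajectory X A | (ω t).1 ≠ z}.indicator 1 ω
            ∂(strategicMeasure p P₀ π) := by
        refine tsum_congr fun t => ?_
        rw [lintegral_indicator_one (hm t)]
        congr 1
        ext ω
        constructor
        · rintro ⟨q, -, hq⟩
          have : (ω t).1 = q.1 := by rw [← hq]
          simpa [this] using q.1.2
        · intro hω
          exact ⟨(⟨(ω t).1, hω⟩, (ω t).2), trivial, rfl⟩
    _ = ∫⁻ ω, ∑' t : ℕ, {ω : Trajectory X A | (ω t).1 ≠ z}.indicator 1 ω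
            ∂(strategicMeasure p P₀ π) :=
        (lintegral_tsum fun t => (measurable_one.indicator (hm t)).aemeasurable).symm
    _ ≤ _ := by
        refine lintegral_mono_ae ?_
        filter_upwards [ae_all_iff.2 fun t => ae_absorbed (P₀ := P₀) hz h.absorbing π t] with ω hω
        exact tsum_indicator_le_hittingTime hω

end Finite

section Projection

variable {X : Type u} {A : Type v} [MeasurableSpace X] [MeasurableSpace A]

/-- The space of all strategic measures for the initial distribution `P₀`, as a subspace of the
probability measures on trajectories with the weak topology. -/
def strategicMeasures (p : Kernel (X × A) X) [IsMarkovKernel p] (P₀ : Measure X) :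
    Set (ProbabilityMeasure (Trajectory X A)) :=
  {P | ∃ π : Strategy X A, (P : Measure (Trajectory X A)) = strategicMeasure p P₀ π}

/-- The space of all occupation measures for the initial distribution `P₀`, as a subspace of the
finite measures on `(X ∖ {z}) × A` with the weak topology. -/
def occupationMeasures (p : Kernel (X × A) X) [IsMarkovKernel p] (P₀ : Measure X) (z : X) :
    Set (FiniteMeasure ({x : X // x ≠ z} × A)) :=
  {η | ∃ π : Strategy X A, (η : Measure ({x : X // x ≠ z} × A)) = occupationMeasure p P₀ z π}

/-- The projection mapping, which sends the strategic measure of a strategy to its occupation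
measure. -/
def projection [TopologicalSpace X] [BorelSpace X] {p : Kernel (X × A) X} [IsMarkovKernel p]
    {P₀ : Measure X} [IsProbabilityMeasure P₀] {z : X} (h : IsAbsorbing p P₀ z)
    (P : strategicMeasures p P₀) : occupationMeasures p P₀ z :=
  ⟨⟨occupation z (P.1 : Measure (Trajectory X A)), by
      obtain ⟨π, hπ⟩ := P.2
      rw [hπ]
      exact isFiniteMeasure_occupationMeasure h π⟩, by
    obtain ⟨π, hπ⟩ := P.2
    exact ⟨π, congrArg (occupation z) hπ⟩⟩

theorem projection_strategicMeasure [TopologicalSpace X] [BorelSpace X] {p : Kernel (X × A) X}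
    [IsMarkovKernel p] {P₀ : Measure X} [IsProbabilityMeasure P₀] {z : X}
    (h : IsAbsorbing p P₀ z) (π : Strategy X A) :
    ((projection h ⟨⟨strategicMeasure p P₀ π, inferInstance⟩, π, rfl⟩).1 :
      Measure ({x : X // x ≠ z} × A)) = occupationMeasure p P₀ z π :=
  rfl

end Projection

end MDP

end

/-!
The idea is that the only obstruction to continuity of the projection is an escape of mass to
infinity in time, and that the space of strategic measures is sequentially compact, so that this
escape can be observed along a convergent sequence.

If the model is uniformly absorbing, the integral of a bounded continuous function against the
occupation measure is a series of weakly continuous functions of the strategic measure (the function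
extends continuously by zero to `X × A`, as `z` is isolated), and its remainders are uniformly
small; see `IsUniformlyAbsorbing.continuous_projection`.

Conversely, if the model is not uniformly absorbing, there are `ε > 0` and strategies `π n` whose
expected time spent off `z` after time `n` exceeds `ε`. Along a convergent subsequence, with limit
`P`, the expected time spent off `z` before any fixed time `m` converges, so the lower limit of the
total masses of the occupation measures exceeds the (finite) total mass of the image of `P` by at
least `ε`, and the projection is discontinuous at `P`; see
`isUniformlyAbsorbing_of_continuous_projection`.

Sequential compactness comes from three facts.

* If the transition kernel is weakly continuous, embed the state space in the Hilbert cube `K`. The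
  probability measures on `(K × A)^ℕ` form a compact space, as `A` is compact. By induction on time,
  weak continuity shows that a limit of strategic measures charges only trajectories with states in `X`
  (`measure_notMem_range_eq_zero_of_tendsto`), so that the convergence takes place on `(X × A)^ℕ`.
* Having initial law `P₀` and transitions `p` is a closed condition, and it characterizes strategic
  measures, by disintegration with respect to the histories (`exists_eq_strategicMeasure`).
* Condition (W) is weak continuity. Under (S), the topology of the state space has a refinement with
  the same Borel sets for which the kernel is weakly continuous
  (`SemiContinuousS.exists_weaklyContinuous`); convergence for the finer topology is more than
  enough.
-/

namespace MDP

/-! ### Weak convergence of probability measures -/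

section WeakConvergence

/-- Weak convergence can be tested after an embedding, because the open sets of the subspace are the
traces of the open sets of the ambient space. -/
theorem tendsto_of_tendsto_map_isInducing {Y Z : Type*} [TopologicalSpace Y]
    [MeasurableSpace Y] [BorelSpace Y] [TopologicalSpace Z]
    [TopologicalSpace.PseudoMetrizableSpace Z] [MeasurableSpace Z] [BorelSpace Z]
    {ι : Type*} {L : Filter ι} [L.IsCountablyGenerated]
    {μs : ι → ProbabilityMeasure Y} {μ : ProbabilityMeasure Y} {e : Y → Z} (he : IsInducing e)
    (h : Tendsto (fun i => (μs i).map he.continuous.measurable.aemeasurable) L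
      (𝓝 (μ.map he.continuous.measurable.aemeasurable))) :
    Tendsto μs L (𝓝 μ) := by
  refine tendsto_of_forall_isOpen_le_liminf' fun G hG => ?_
  obtain ⟨U, hU, rfl⟩ := he.isOpen_iff.1 hG
  have := ProbabilityMeasure.le_liminf_measure_open_of_tendsto h hU
  simpa only [ProbabilityMeasure.toMeasure_map,
    Measure.map_apply he.continuous.measurable hU.measurableSet] using this

theorem exists_map_eq_of_measurableEmbedding {Y Z : Type*} [MeasurableSpace Y] [MeasurableSpace Z]
    {e : Y → Z} (he : MeasurableEmbedding e)
    (μ : ProbabilityMeasure Z) (hμ : (μ : Measure Z) (Set.range e)ᶜ = 0) :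
    ∃ ν : ProbabilityMeasure Y, ν.map he.measurable.aemeasurable = μ := by
  have h : ((μ : Measure Z).comap e).map e = μ := by
    rw [he.map_comap, Measure.restrict_eq_self_of_ae_mem]
    exact hμ
  have hp : IsProbabilityMeasure ((μ : Measure Z).comap e) := by
    rw [← Measure.isProbabilityMeasure_map_iff he.measurable.aemeasurable, h]
    infer_instance
  exact ⟨⟨_, hp⟩, Subtype.ext h⟩

/-- The value at `y` of a Markov kernel, as a point of the space of probability measures. -/
def kernelProba {Y Z : Type*} [MeasurableSpace Y] [MeasurableSpace Z] (κ : Kernel Y Z)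
    [IsMarkovKernel κ] (y : Y) : ProbabilityMeasure Z :=
  ⟨κ y, inferInstance⟩

/-- The law of a pair whose first component has law `μ` and whose second component has conditional
law `κ` given the first one, as a point of the space of probability measures. -/
noncomputable def compProdProba {Y Z : Type*} [MeasurableSpace Y] [MeasurableSpace Z]
    (μ : ProbabilityMeasure Y) (κ : Kernel Y Z) [IsMarkovKernel κ] : ProbabilityMeasure (Y × Z) :=
  ⟨μ ⊗ₘ κ, inferInstance⟩

/-- A Markov kernel is weakly continuous (has the Feller property) if `y ↦ κ y` is continuous for
the weak topology of probability measures. -/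
def WeaklyContinuous {Y Z : Type*} [TopologicalSpace Y] [MeasurableSpace Y] [TopologicalSpace Z]
    [MeasurableSpace Z] [OpensMeasurableSpace Z] (κ : Kernel Y Z) [IsMarkovKernel κ] : Prop :=
  Continuous (kernelProba κ)

theorem WeaklyContinuous.comap {Y Y' Z : Type*} [TopologicalSpace Y] [MeasurableSpace Y]
    [TopologicalSpace Y'] [MeasurableSpace Y'] [TopologicalSpace Z] [MeasurableSpace Z]
    [OpensMeasurableSpace Z] {κ : Kernel Y Z} [IsMarkovKernel κ] (hκ : WeaklyContinuous κ)
    {g : Y' → Y} (hg : Continuous g)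
    (hgm : Measurable g) : WeaklyContinuous (κ.comap g hgm) :=
  Continuous.comp (g := kernelProba κ) hκ hg

/-- If `μ i` tends to `μ` and `κ` is weakly continuous, the joint laws `μ i ⊗ₘ κ` tend to `μ ⊗ₘ κ`:
the integral of `f` over the second variable is a bounded continuous function of the first one. -/
theorem WeaklyContinuous.tendsto_compProd {Y Z : Type*} [TopologicalSpace Y]
    [TopologicalSpace.PseudoMetrizableSpace Y] [SecondCountableTopology Y] [MeasurableSpace Y]
    [BorelSpace Y] [TopologicalSpace Z] [TopologicalSpace.PseudoMetrizableSpace Z]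
    [SecondCountableTopology Z] [MeasurableSpace Z] [BorelSpace Z] {κ : Kernel Y Z}
    [IsMarkovKernel κ] (hκ : WeaklyContinuous κ) {ι : Type*} {L : Filter ι}
    {μs : ι → ProbabilityMeasure Y} {μ : ProbabilityMeasure Y} (h : Tendsto μs L (𝓝 μ)) :
    Tendsto (fun i => compProdProba (μs i) κ) L (𝓝 (compProdProba μ κ)) := by
  rw [ProbabilityMeasure.tendsto_iff_forall_integral_tendsto]
  intro f
  -- `κ y` seen on `Y × Z`, over the point `y`, depends continuously on `y`.
  have hG : Continuous fun y => (diracProba y).prod (kernelProba κ y) :=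
    ProbabilityMeasure.continuous_prod.comp (continuous_diracProba.prodMk hκ)
  have hF := ProbabilityMeasure.continuous_iff_forall_continuous_integral.1 hG f
  have hFe : ∀ y, ∫ q, f q ∂((diracProba y).prod (kernelProba κ y) : Measure (Y × Z)) =
      ∫ z, f (y, z) ∂κ y := by
    intro y
    change ∫ q, f q ∂((Measure.dirac y).prod (κ y)) = _
    rw [Measure.dirac_prod, integral_map (by fun_prop) f.continuous.aestronglyMeasurable]
  simp only [hFe] at hF
  have hint : ∀ ν : ProbabilityMeasure Y, ∫ q, f q ∂(compProdProba ν κ : Measure (Y × Z)) =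
      ∫ y, ∫ z, f (y, z) ∂κ y ∂(ν : Measure Y) := fun ν =>
    Measure.integral_compProd (f.integrable (compProdProba ν κ : Measure (Y × Z)))
  simp only [hint]
  let F : BoundedContinuousFunction Y ℝ := BoundedContinuousFunction.ofNormedAddCommGroup
    (fun y => ∫ z, f (y, z) ∂κ y) hF ‖f‖ fun y => by
      refine (norm_integral_le_of_norm_le_const (C := ‖f‖)
        (Eventually.of_forall fun z => f.norm_coe_le_norm _)).trans ?_
      simp
  exact (ProbabilityMeasure.tendsto_iff_forall_integral_tendsto.1 h) F

end WeakConvergence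

/-! ### Characterization of strategic measures -/

section Characterization

variable {X A : Type*}

/-- The history up to time `t + 1`, as a function of the history up to time `t`, the action `a_{t+1}`
and the state `x_{t+1}`. -/
def extendHistory (t : ℕ) (q : (History X A t × A) × X) : History X A (t + 1) :=
  (Fin.snoc (α := fun _ => X × A) q.1.1.1 (q.1.1.2, q.1.2), q.2)

theorem extendHistory_history (t : ℕ) (ω : Trajectory X A) :
    extendHistory t ((history t ω, (ω t).2), (ω (t + 1)).1) = history (t + 1) ω := by
  refine Prod.ext (funext fun i => ?_) rfl
  refine Fin.lastCases ?_ (fun j => ?_) i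
  · simp [extendHistory, history]
  · simp [extendHistory, history]

theorem history_zero (ω : Trajectory X A) :
    history 0 ω = ((Fin.elim0 : Fin 0 → X × A), (ω 0).1) :=
  Prod.ext (Subsingleton.elim _ _) rfl

variable [MeasurableSpace X] [MeasurableSpace A]

theorem measurable_extendHistory (t : ℕ) : Measurable (extendHistory (X := X) (A := A) t) := by
  unfold extendHistory
  refine Measurable.prodMk ?_ measurable_snd
  rw [measurable_pi_iff]
  intro i
  refine Fin.lastCases ?_ (fun j => ?_) i
  · simp only [Fin.snoc_last]; fun_prop
  · simp only [Fin.snoc_castSucc]; fun_prop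

/-- A law on trajectories is determined by the laws of all the pairs of history and next action. -/
theorem ext_of_map_history_action {P Q : Measure (Trajectory X A)} [IsFiniteMeasure P]
    [IsFiniteMeasure Q]
    (h : ∀ t, P.map (fun ω => (history t ω, (ω t).2)) = Q.map (fun ω => (history t ω, (ω t).2))) :
    P = Q := by
  have key : ∀ I : Finset ℕ, P.map I.restrict = Q.map I.restrict := by
    intro I
    obtain ⟨t, ht⟩ : ∃ t, ∀ i ∈ I, i < t := ⟨I.sup id + 1, fun i hi =>
      Nat.lt_succ_of_le (Finset.le_sup (f := id) hi)⟩
    let g : History X A t × A → (i : I) → X × A := fun q i => q.1.1 ⟨i, ht i i.2⟩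
    have hg : Measurable g := by fun_prop
    have hm : Measurable fun ω : Trajectory X A => (history t ω, (ω t).2) :=
      (measurable_history t).prodMk (by fun_prop)
    have := congrArg (Measure.map g) (h t)
    rwa [Measure.map_map hg hm, Measure.map_map hg hm] at this
  exact IsProjectiveLimit.unique (P := fun I => P.map I.restrict) (fun I => rfl)
    (fun I => (key I).symm)

/-- A law on trajectories is a strategic measure as soon as the initial state has law `P₀` and the
transitions are those of `p`: the strategy is given by the conditional laws of the actions. -/
theorem exists_eq_strategicMeasure [StandardBorelSpace A] [Nonempty A] (p : Kernel (X × A) X)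
    [IsMarkovKernel p] (P₀ : Measure X) [IsProbabilityMeasure P₀] (P : Measure (Trajectory X A))
    [IsProbabilityMeasure P] (h0 : P.map (fun ω => (ω 0).1) = P₀)
    (hs : ∀ t, P.map (fun ω => ((history t ω, (ω t).2), (ω (t + 1)).1)) =
      P.map (fun ω => (history t ω, (ω t).2)) ⊗ₘ
        p.comap (fun q : History X A t × A => (q.1.2, q.2)) (by fun_prop)) :
    ∃ π : Strategy X A, P = strategicMeasure p P₀ π := by
  let π : Strategy X A :=
    ⟨fun t => condDistrib (fun ω : Trajectory X A => (ω t).2) (history t) P, fun t => inferInstance⟩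
  have hP : ∀ t, P.map (fun ω => (history t ω, (ω t).2)) = P.map (history t) ⊗ₘ π.kernel t :=
    fun t => (compProd_map_condDistrib (Measurable.aemeasurable (by fun_prop))).symm
  have hm : ∀ t, Measurable fun ω : Trajectory X A => ((history t ω, (ω t).2), (ω (t + 1)).1) :=
    fun t => ((measurable_history t).prodMk (by fun_prop)).prodMk (by fun_prop)
  have hH : ∀ t, P.map (history t) = (strategicMeasure p P₀ π).map (history t) := by
    intro t
    induction t with
    | zero =>
      have hf : Measurable fun x : X => ((Fin.elim0 : Fin 0 → X × A), x) := by fun_prop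
      have := congrArg (Measure.map fun x : X => ((Fin.elim0 : Fin 0 → X × A), x))
        (h0.trans (strategicMeasure_initial p P₀ π).symm)
      rw [Measure.map_map hf (by fun_prop), Measure.map_map hf (by fun_prop)] at this
      rwa [funext history_zero]
    | succ t ih =>
      have h := hs t
      rw [hP t, ih, ← strategicMeasure_action, ← strategicMeasure_transition] at h
      have h2 := congrArg (Measure.map (extendHistory t)) h
      rw [Measure.map_map (measurable_extendHistory t) (hm t),
        Measure.map_map (measurable_extendHistory t) (hm t)] at h2
      have he := funext (extendHistory_history (X := X) (A := A) t)
      rw [← he]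
      exact h2
  refine ⟨π, ext_of_map_history_action fun t => ?_⟩
  rw [hP, hH, strategicMeasure_action]

end Characterization

/-! ### Sequential compactness for weakly continuous kernels -/

section Compactness

theorem measurable_state {X A : Type*} [MeasurableSpace X] [MeasurableSpace A] (t : ℕ) :
    Measurable fun ω : Trajectory X A => (ω t).1 := by
  fun_prop

theorem continuous_history {X A : Type*} [TopologicalSpace X] [TopologicalSpace A] (t : ℕ) :
    Continuous (history (X := X) (A := A) t) := by
  unfold history
  fun_prop

variable {X A : Type*} [TopologicalSpace X] [TopologicalSpace.MetrizableSpace X]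
  [SecondCountableTopology X] [MeasurableSpace X] [BorelSpace X]
  [TopologicalSpace A] [TopologicalSpace.MetrizableSpace A] [CompactSpace A]
  [MeasurableSpace A] [BorelSpace A]

/-- The strategic measure of a strategy as a point of the space of probability measures. -/
noncomputable def strategicProba (p : Kernel (X × A) X) [IsMarkovKernel p] (P₀ : Measure X)
    [IsProbabilityMeasure P₀] (π : Strategy X A) : ProbabilityMeasure (Trajectory X A) :=
  ⟨strategicMeasure p P₀ π, inferInstance⟩

variable {K : Type*} [TopologicalSpace K] [TopologicalSpace.MetrizableSpace K] [CompactSpace K]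
  [MeasurableSpace K] [BorelSpace K]

/-- The map of trajectories induced by a map `e` of the state space. -/
def mapTrajectory {X K A : Type*} (e : X → K) : Trajectory X A → Trajectory K A :=
  Pi.map fun _ => Prod.map e id

theorem isInducing_mapTrajectory {X K A : Type*} [TopologicalSpace X] [TopologicalSpace K]
    [TopologicalSpace A] {e : X → K} (he : IsInducing e) :
    IsInducing (mapTrajectory (A := A) e) :=
  IsInducing.piMap fun _ => he.prodMap IsInducing.id

theorem mem_range_mapTrajectory {X K A : Type*} {e : X → K} {ω : Trajectory K A} :
    ω ∈ Set.range (mapTrajectory e) ↔ ∀ t, (ω t).1 ∈ Set.range e := by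
  constructor
  · rintro ⟨ω, rfl⟩ t
    exact ⟨_, rfl⟩
  · intro h
    choose x hx using h
    exact ⟨fun t => (x t, (ω t).2), funext fun t => Prod.ext (hx t) rfl⟩

theorem measurableEmbedding_mapTrajectory {X K A : Type*} [MeasurableSpace X]
    [StandardBorelSpace X] [MeasurableSpace K] [StandardBorelSpace K] [MeasurableSpace A]
    [StandardBorelSpace A] {e : X → K} (he : Measurable e) (hi : Function.Injective e) :
    MeasurableEmbedding (mapTrajectory (A := A) e) := by
  have hm : Measurable (mapTrajectory (A := A) e) := by
    rw [measurable_pi_iff]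
    intro t
    simp only [mapTrajectory, Pi.map_apply]
    fun_prop
  exact hm.measurableEmbedding (Function.Injective.piMap fun _ => hi.prodMap Function.injective_id)

/-- A limit of strategic measures in an enlarged state space charges only states of the original
space. By induction on `t`: once the limit law of `(x_t, a_{t+1})` lives on `X × A`, weak continuity of
`p` yields a limit law of `x_{t+1}` on `X`. -/
theorem measure_notMem_range_eq_zero_of_tendsto {p : Kernel (X × A) X} [IsMarkovKernel p]
    (hp : WeaklyContinuous p) (P₀ : Measure X) [IsProbabilityMeasure P₀] {e : X → K}
    (he : IsEmbedding e) (heX : MeasurableEmbedding e) (π : ℕ → Strategy X A)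
    {Q : ProbabilityMeasure (Trajectory K A)}
    (hQ : Tendsto (fun n => (strategicProba p P₀ (π n)).map
      (isInducing_mapTrajectory he.isInducing).continuous.measurable.aemeasurable) atTop (𝓝 Q))
    (t : ℕ) : (Q : Measure (Trajectory K A)) {ω | (ω t).1 ∉ Set.range e} = 0 := by
  have hc : Continuous (mapTrajectory (A := A) e) :=
    (isInducing_mapTrajectory he.isInducing).continuous
  have hr : MeasurableSet (Set.range e) := heX.measurableSet_range
  -- The law of the state at time `t` under `Q` is the limit of the laws under the given sequence.
  have hQt : ∀ t, Tendsto (fun n => (((strategicProba p P₀ (π n)).map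
      (measurable_state t).aemeasurable).map heX.measurable.aemeasurable)) atTop
      (𝓝 (Q.map (measurable_state t).aemeasurable)) := by
    intro t
    have := ProbabilityMeasure.tendsto_map_of_tendsto_of_continuous _ _ hQ
      (f := fun ω : Trajectory K A => (ω t).1) (by fun_prop)
    refine this.congr fun n => Subtype.ext ?_
    simp only [ProbabilityMeasure.val_eq_to_measure, ProbabilityMeasure.toMeasure_map]
    rw [Measure.map_map (by fun_prop) hc.measurable, Measure.map_map heX.measurable (by fun_prop)]
    rfl
  -- It is concentrated on the range of `e` as soon as the laws before the embedding converge.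
  have hlim : ∀ t (ρ : ProbabilityMeasure X), Tendsto (fun n => (strategicProba p P₀ (π n)).map
      (measurable_state t).aemeasurable) atTop (𝓝 ρ) →
      (Q : Measure (Trajectory K A)) {ω | (ω t).1 ∉ Set.range e} = 0 := by
    intro t ρ hρ
    have h1 := ProbabilityMeasure.tendsto_map_of_tendsto_of_continuous _ _ hρ he.continuous
    have h2 := congrArg (fun ν : ProbabilityMeasure K => (ν : Measure K) (Set.range e)ᶜ)
      (tendsto_nhds_unique (hQt t) h1)
    simp only [ProbabilityMeasure.toMeasure_map] at h2
    rw [Measure.map_apply (by fun_prop) hr.compl, Measure.map_apply heX.measurable hr.compl] at h2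
    refine Eq.trans h2 ?_
    convert measure_empty (μ := (ρ : Measure X))
    ext x
    simp
  induction t with
  | zero =>
    refine hlim 0 ⟨P₀, inferInstance⟩ (tendsto_const_nhds.congr fun n => Subtype.ext ?_)
    exact (strategicMeasure_initial p P₀ (π n)).symm
  | succ t ih =>
    have hi : IsInducing (Prod.map e (id : A → A)) := he.isInducing.prodMap IsInducing.id
    have hpm : MeasurableEmbedding (Prod.map e (id : A → A)) := heX.prodMap MeasurableEmbedding.id
    obtain ⟨ρ, hρ⟩ := exists_map_eq_of_measurableEmbedding hpm
      (Q.map (measurable_pi_apply t).aemeasurable) (by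
        rw [ProbabilityMeasure.toMeasure_map,
          Measure.map_apply (by fun_prop) hpm.measurableSet_range.compl]
        convert ih using 2
        ext ω
        simp [Set.range_prodMap])
    -- The laws of `(x_t, a_{t+1})` converge on `X × A`, not only after the embedding.
    have h1 : Tendsto (fun n => (strategicProba p P₀ (π n)).map 
        (measurable_pi_apply t).aemeasurable) atTop (𝓝 ρ) := by
      refine tendsto_of_tendsto_map_isInducing hi ?_
      have := ProbabilityMeasure.tendsto_map_of_tendsto_of_continuous _ _ hQ
        (f := fun ω : Trajectory K A => ω t) (by fun_prop)
      rw [hρ]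
      refine this.congr fun n => Subtype.ext ?_
      simp only [ProbabilityMeasure.val_eq_to_measure, ProbabilityMeasure.toMeasure_map]
      rw [Measure.map_map (by fun_prop) hc.measurable, Measure.map_map hpm.measurable (by fun_prop)]
      rfl
    have h2 := ProbabilityMeasure.tendsto_map_of_tendsto_of_continuous _ _
      (hp.tendsto_compProd h1) continuous_snd
    refine hlim (t + 1) _ (h2.congr fun n => Subtype.ext ?_)
    simp only [ProbabilityMeasure.val_eq_to_measure, ProbabilityMeasure.toMeasure_map]
    have h3 := strategicMeasure_transition p P₀ (π n) t
    have h4 := map_compProd_comap ((strategicMeasure p P₀ (π n)).map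
      (fun ω => (history t ω, (ω t).2))) p (f := fun q : History X A t × A => (q.1.2, q.2))
      (by fun_prop)
    have hm : Measurable fun ω : Trajectory X A => (history t ω, (ω t).2) :=
      (measurable_history t).prodMk (by fun_prop)
    rw [← h3, Measure.map_map (by fun_prop) (hm.prodMk (by fun_prop)),
      Measure.map_map (by fun_prop) hm] at h4
    change ((strategicMeasure p P₀ (π n)).map (fun ω => ω t) ⊗ₘ p).map Prod.snd = _
    refine (congrArg (Measure.map Prod.snd) h4.symm).trans ?_
    rw [Measure.map_map (by fun_prop) ?_]
    · rfl
    · exact (Measurable.prodMk (by fun_prop) (by fun_prop)).comp (hm.prodMk (by fun_prop))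

/-- The set of strategic measures is closed under limits of sequences: the initial law and the
transition laws pass to the limit. -/
theorem exists_eq_strategicProba_of_tendsto [StandardBorelSpace A] [Nonempty A]
    {p : Kernel (X × A) X} [IsMarkovKernel p] (hp : WeaklyContinuous p) (P₀ : Measure X)
    [IsProbabilityMeasure P₀] (π : ℕ → Strategy X A) {P : ProbabilityMeasure (Trajectory X A)}
    (hP : Tendsto (fun n => strategicProba p P₀ (π n)) atTop (𝓝 P)) :
    ∃ π' : Strategy X A, P = strategicProba p P₀ π' := by
  have h0 : (P : Measure (Trajectory X A)).map (fun ω => (ω 0).1) = P₀ := by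
    have h := ProbabilityMeasure.tendsto_map_of_tendsto_of_continuous _ _ hP
      (f := fun ω : Trajectory X A => (ω 0).1) (by fun_prop)
    let ν : ProbabilityMeasure X := ⟨P₀, inferInstance⟩
    have h' : Tendsto (fun n => (strategicProba p P₀ (π n)).map
        (measurable_state 0).aemeasurable) atTop (𝓝 ν) :=
      tendsto_const_nhds.congr fun n => Subtype.ext (strategicMeasure_initial p P₀ (π n)).symm
    exact congrArg ProbabilityMeasure.toMeasure (tendsto_nhds_unique h h')
  refine (exists_eq_strategicMeasure p P₀ P h0 fun t => ?_).imp fun π' hπ' => Subtype.ext hπ'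
  have hc : Continuous fun ω : Trajectory X A => (history t ω, (ω t).2) :=
    (continuous_history t).prodMk (by fun_prop)
  have h1 := ProbabilityMeasure.tendsto_map_of_tendsto_of_continuous _ _ hP hc
  have hg : Continuous fun q : History X A t × A => (q.1.2, q.2) := by fun_prop
  have h2 := (hp.comap hg hg.measurable).tendsto_compProd h1
  have h3 := ProbabilityMeasure.tendsto_map_of_tendsto_of_continuous _ _ hP
    (f := fun ω : Trajectory X A => ((history t ω, (ω t).2), (ω (t + 1)).1))
    (hc.prodMk (by fun_prop))
  refine congrArg ProbabilityMeasure.toMeasure (tendsto_nhds_unique (h3.congr fun n => ?_) h2)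
  exact Subtype.ext (strategicMeasure_transition p P₀ (π n) t)

/-- For a weakly continuous kernel, every sequence of strategic measures has a subsequence that
converges to a strategic measure. -/
theorem exists_subseq_tendsto_strategicProba [StandardBorelSpace X] [StandardBorelSpace A]
    [Nonempty A] {p : Kernel (X × A) X} [IsMarkovKernel p] (hp : WeaklyContinuous p)
    (P₀ : Measure X) [IsProbabilityMeasure P₀] (π : ℕ → Strategy X A) :
    ∃ (π' : Strategy X A) (φ : ℕ → ℕ), StrictMono φ ∧
      Tendsto (fun n => strategicProba p P₀ (π (φ n))) atTop (𝓝 (strategicProba p P₀ π')) := by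
  let _ := TopologicalSpace.metrizableSpaceMetric X
  obtain ⟨e, he⟩ := Metric.PiNatEmbed.exists_embedding_to_hilbert_cube (X := X)
  have heX : MeasurableEmbedding e := he.continuous.measurable.measurableEmbedding he.injective
  have hE1 := isInducing_mapTrajectory (A := A) he.isInducing
  have hE2 := measurableEmbedding_mapTrajectory (A := A) heX.measurable he.injective
  obtain ⟨Q, -, φ, hφ, hQ⟩ := (isCompact_univ (X := ProbabilityMeasure
    (Trajectory (ℕ → unitInterval) A))).tendsto_subseq
      (x := fun n => (strategicProba p P₀ (π n)).map hE1.continuous.measurable.aemeasurable)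
      (fun _ => Set.mem_univ _)
  obtain ⟨P, rfl⟩ := exists_map_eq_of_measurableEmbedding hE2 Q (by
    have : (Set.range (mapTrajectory (A := A) e))ᶜ = ⋃ t, {ω | (ω t).1 ∉ Set.range e} := by
      ext ω
      rw [Set.mem_compl_iff, mem_range_mapTrajectory]
      simp only [Set.mem_iUnion, Set.mem_ofPred_eq, not_forall]
    rw [this, measure_iUnion_null_iff]
    exact measure_notMem_range_eq_zero_of_tendsto hp P₀ he heX (fun n => π (φ n)) hQ)
  have hP : Tendsto (fun n => strategicProba p P₀ (π (φ n))) atTop (𝓝 P) :=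
    tendsto_of_tendsto_map_isInducing hE1 hQ
  obtain ⟨π', rfl⟩ := exists_eq_strategicProba_of_tendsto hp P₀ _ hP
  exact ⟨π', φ, hφ, hP⟩

end Compactness

/-! ### Refinement of the topology of the state space under (S) -/

section StandardBorel

theorem standardBorelSpace_of_measurableEquiv {Y Z : Type*} [MeasurableSpace Y] [MeasurableSpace Z]
    [StandardBorelSpace Z] (e : Y ≃ᵐ Z) : StandardBorelSpace Y := by
  obtain ⟨τ, hb, hp⟩ := StandardBorelSpace.polish (α := Z)
  let τY : TopologicalSpace Y := τ.induced e
  refine ⟨⟨τY, ⟨?_⟩, ?_⟩⟩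
  · exact e.measurableEmbedding.comap_eq.symm.trans
      ((congrArg (MeasurableSpace.comap e) hb.measurable_eq).trans borel_comap.symm)
  · exact (e.toEquiv.toHomeomorphOfIsInducing ⟨rfl⟩).isClosedEmbedding.polishSpace

theorem TopologicalBorelSpace.standardBorelSpace (X : Type*) [TopologicalSpace X]
    [h : TopologicalBorelSpace X] [MeasurableSpace X] [BorelSpace X] : StandardBorelSpace X := by
  obtain ⟨Y, _, _, f, hf, hr⟩ := h.exists_embedding
  let _ : MeasurableSpace Y := borel Y
  have : BorelSpace Y := ⟨rfl⟩
  have := hr.standardBorel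
  exact standardBorelSpace_of_measurableEquiv (hf.measurableEmbedding hr).equivRange

end StandardBorel

section Refinement

/-- A countable family of measurable sets is contained in a countable algebra of measurable sets
that is stable under countably many given set operations. -/
theorem exists_countable_isSetAlgebra {X ι : Type*} [MeasurableSpace X] [Countable ι]
    (F : ι → Set X → Set X) (hF : ∀ i s, MeasurableSet s → MeasurableSet (F i s))
    {𝒞₀ : Set (Set X)} (hc : 𝒞₀.Countable) (hm : ∀ s ∈ 𝒞₀, MeasurableSet s) :
    ∃ 𝒞 : Set (Set X), 𝒞₀ ⊆ 𝒞 ∧ 𝒞.Countable ∧ (∀ s ∈ 𝒞, MeasurableSet s) ∧ IsSetAlgebra 𝒞 ∧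
      ∀ i, ∀ s ∈ 𝒞, F i s ∈ 𝒞 := by
  let step : Set (Set X) → Set (Set X) := fun 𝒜 => generateSetAlgebra (𝒜 ∪ ⋃ i, F i '' 𝒜)
  let 𝒮 : ℕ → Set (Set X) := fun n => step^[n] (generateSetAlgebra 𝒞₀)
  have hsucc : ∀ n, 𝒮 (n + 1) = generateSetAlgebra (𝒮 n ∪ ⋃ i, F i '' 𝒮 n) := fun n =>
    Function.iterate_succ_apply' _ _ _
  have hmono : Monotone 𝒮 := monotone_nat_of_le_succ fun n => by
    rw [hsucc]
    exact Set.subset_union_left.trans self_subset_generateSetAlgebra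
  have halg : ∀ n, IsSetAlgebra (𝒮 n) := by
    rintro (_ | n)
    · exact isSetAlgebra_generateSetAlgebra
    · rw [hsucc]
      exact isSetAlgebra_generateSetAlgebra
  have hgen : ∀ 𝒜 : Set (Set X), (∀ s ∈ 𝒜, MeasurableSet s) →
      ∀ s ∈ generateSetAlgebra 𝒜, MeasurableSet s := by
    intro 𝒜 h𝒜 s hs
    have := MeasurableSpace.measurableSet_generateFrom hs
    rw [generateFrom_generateSetAlgebra_eq] at this
    exact MeasurableSpace.generateFrom_le h𝒜 s this
  refine ⟨⋃ n, 𝒮 n, ?_, Set.countable_iUnion fun n => ?_, ?_, ⟨?_, ?_, ?_⟩, ?_⟩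
  · exact self_subset_generateSetAlgebra.trans (Set.subset_iUnion 𝒮 0)
  · induction n with
    | zero => exact countable_generateSetAlgebra hc
    | succ n ih =>
      rw [hsucc]
      exact countable_generateSetAlgebra
        (ih.union (Set.countable_iUnion fun i => ih.image _))
  · have : ∀ n, ∀ s ∈ 𝒮 n, MeasurableSet s := by
      intro n
      induction n with
      | zero => exact hgen _ hm
      | succ n ih =>
        rw [hsucc]
        refine hgen _ ?_
        rintro s (hs | hs)
        · exact ih s hs
        · obtain ⟨i, t, ht, rfl⟩ := Set.mem_iUnion.1 hs
          exact hF i t (ih t ht)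
    intro s hs
    obtain ⟨n, hn⟩ := Set.mem_iUnion.1 hs
    exact this n s hn
  · exact Set.mem_iUnion.2 ⟨0, (halg 0).empty_mem⟩
  · intro s hs
    obtain ⟨n, hn⟩ := Set.mem_iUnion.1 hs
    exact Set.mem_iUnion.2 ⟨n, (halg n).compl_mem hn⟩
  · intro s t hs ht
    obtain ⟨n, hn⟩ := Set.mem_iUnion.1 hs
    obtain ⟨m, hm⟩ := Set.mem_iUnion.1 ht
    exact Set.mem_iUnion.2 ⟨max n m, (halg _).union_mem (hmono (le_max_left n m) hn)
      (hmono (le_max_right n m) hm)⟩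
  · intro i s hs
    obtain ⟨n, hn⟩ := Set.mem_iUnion.1 hs
    refine Set.mem_iUnion.2 ⟨n + 1, ?_⟩
    rw [hsucc]
    exact self_subset_generateSetAlgebra (Or.inr (Set.mem_iUnion.2 ⟨i, s, hn, rfl⟩))

/-- A set algebra is a basis, and not only a subbasis, of the topology that it generates. -/
theorem isTopologicalBasis_of_isSetAlgebra {X : Type*} [t : TopologicalSpace X] {𝒞 : Set (Set X)}
    (h𝒞 : IsSetAlgebra 𝒞) (ht : t = TopologicalSpace.generateFrom 𝒞) :
    TopologicalSpace.IsTopologicalBasis 𝒞 where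
  exists_subset_inter s hs u hu _ hx := ⟨s ∩ u, h𝒞.inter_mem hs hu, hx, subset_rfl⟩
  sUnion_eq := Set.eq_univ_of_univ_subset (Set.subset_sUnion_of_mem h𝒞.univ_mem)
  eq_generateFrom := ht

/-- A `T0` topology with a countable basis that is an algebra of sets is metrizable, as the basic
sets are clopen. -/
theorem metrizableSpace_of_isSetAlgebra {X : Type*} [t : TopologicalSpace X] [T0Space X]
    {𝒞 : Set (Set X)} (h𝒞 : IsSetAlgebra 𝒞) (hc : 𝒞.Countable)
    (hb : TopologicalSpace.IsTopologicalBasis 𝒞) : TopologicalSpace.MetrizableSpace X := by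
  have : RegularSpace X := RegularSpace.of_exists_mem_nhds_isClosed_subset fun x s hs => by
    obtain ⟨C, hC, hx, hCs⟩ := hb.mem_nhds_iff.1 hs
    exact ⟨C, hb.mem_nhds hC hx, ⟨hb.isOpen (h𝒞.compl_mem hC)⟩, hCs⟩
  have := hb.secondCountableTopology hc
  exact TopologicalSpace.metrizableSpace_of_t3_secondCountable X

/-- Lower semicontinuity of the mass of the sets in a countable basis that is stable under finite
unions implies weak continuity, because the mass of an open set is the supremum of the masses of the
basic sets that it contains. -/
theorem weaklyContinuous_of_lowerSemicontinuous {Y Z : Type*} [TopologicalSpace Y]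
    [FirstCountableTopology Y] [MeasurableSpace Y] [TopologicalSpace Z] [MeasurableSpace Z]
    [OpensMeasurableSpace Z] {κ : Kernel Y Z} [IsMarkovKernel κ] {𝒞 : Set (Set Z)}
    (h𝒞 : IsSetAlgebra 𝒞) (hc : 𝒞.Countable) (hb : TopologicalSpace.IsTopologicalBasis 𝒞)
    (h : ∀ C ∈ 𝒞, LowerSemicontinuous fun y => κ y C) : WeaklyContinuous κ := by
  refine continuous_iff_continuousAt.2 fun y => tendsto_of_forall_isOpen_le_liminf' fun U hU => ?_
  change κ y U ≤ (𝓝 y).liminf fun y' => κ y' U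
  have hUe : U = ⋃ C ∈ {C | C ∈ 𝒞 ∧ C ⊆ U}, C := by
    rw [← Set.sUnion_eq_biUnion]
    exact hb.open_eq_sUnion' hU
  have hdir : DirectedOn (Function.onFun (· ⊆ ·) fun C : Set Z => C) {C | C ∈ 𝒞 ∧ C ⊆ U} :=
    fun C hC D hD => ⟨C ∪ D, ⟨h𝒞.union_mem hC.1 hD.1, Set.union_subset hC.2 hD.2⟩,
      Set.subset_union_left, Set.subset_union_right⟩
  conv_lhs => rw [hUe]
  rw [measure_biUnion_eq_iSup (hc.mono fun C hC => hC.1) hdir]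
  refine iSup₂_le fun C hC => (lowerSemicontinuousAt_iff_le_liminf.1 (h C hC.1 y)).trans ?_
  exact liminf_le_liminf (Eventually.of_forall fun y' => measure_mono hC.2)

variable {X A : Type*} [MeasurableSpace X] [MeasurableSpace A] [TopologicalSpace A]

theorem SemiContinuousS.continuous_measureReal {p : Kernel (X × A) X} (h : SemiContinuousS p)
    (x : X) {C : Set X} (hC : MeasurableSet C) : Continuous fun a : A => (p (x, a)).real C := by
  have := h.continuous_integral x (C.indicator 1) (measurable_one.indicator hC)
    ⟨1, fun y => by by_cases hy : y ∈ C <;> simp [hy]⟩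
  simpa only [integral_indicator_one hC] using this

/-- The set of states from which all the actions in `V` lead to `C` with probability at least `s`. -/
def robustSet (p : Kernel (X × A) X) (V : Set A) (s : ℝ) (C : Set X) : Set X :=
  {x | ∀ a ∈ V, s ≤ (p (x, a)).real C}

/-- By continuity in the action, a robust set for an open set of actions is a countable
intersection over a dense set of actions. -/
theorem SemiContinuousS.measurableSet_robustSet [TopologicalSpace.SeparableSpace A]
    {p : Kernel (X × A) X} (h : SemiContinuousS p) {V : Set A} (hV : IsOpen V) (s : ℝ)
    {C : Set X} (hC : MeasurableSet C) : MeasurableSet (robustSet p V s C) := by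
  obtain ⟨D, hDc, hD⟩ := TopologicalSpace.exists_countable_dense A
  have : robustSet p V s C = ⋂ a ∈ D ∩ V, {x | s ≤ (p (x, a)).real C} := by
    ext x
    simp only [robustSet, Set.mem_iInter, Set.mem_ofPred_eq]
    refine ⟨fun hx a ha => hx a ha.2, fun hx a ha => ?_⟩
    by_contra! hlt
    have ho : IsOpen (V ∩ {a | (p (x, a)).real C < s}) :=
      hV.inter (isOpen_lt (h.continuous_measureReal x hC) continuous_const)
    obtain ⟨b, hb, hbD⟩ := hD.inter_open_nonempty _ ho ⟨a, ha, hlt⟩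
    exact absurd hb.2 (not_lt.2 (hx b ⟨hbD, hb.1⟩))
  rw [this]
  refine MeasurableSet.biInter (hDc.mono Set.inter_subset_left) fun a _ => ?_
  have hm : Measurable fun x : X => (p (x, a)).real C :=
    ((p.measurable_coe hC).comp (measurable_id.prodMk measurable_const)).ennreal_toReal
  exact measurableSet_le measurable_const hm

/-- If the sets of states from which basic open sets of actions lead to `C` with at least a given
rational probability are open, then the probability to reach `C` is lower semicontinuous in the state
and the action. -/
theorem SemiContinuousS.lowerSemicontinuous [TopologicalSpace X] [SecondCountableTopology A]
    {p : Kernel (X × A) X} [IsMarkovKernel p] (h : SemiContinuousS p) {C : Set X}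
    (hC : MeasurableSet C)
    (ho : ∀ V ∈ TopologicalSpace.countableBasis A, ∀ s : ℚ, IsOpen (robustSet p V s C)) :
    LowerSemicontinuous fun q : X × A => p q C := by
  rintro ⟨x, a⟩ r hr
  have hr' : r ≠ ∞ := hr.ne_top
  have hlt : r.toReal < (p (x, a)).real C :=
    (ENNReal.toReal_lt_toReal hr' (measure_ne_top _ _)).2 hr
  obtain ⟨s, hs1, hs2⟩ := exists_rat_btwn hlt
  have hn : {b | (s : ℝ) < (p (x, b)).real C} ∈ 𝓝 a :=
    (isOpen_lt continuous_const (h.continuous_measureReal x hC)).mem_nhds hs2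
  obtain ⟨V, hV, haV, hVs⟩ := (TopologicalSpace.isBasis_countableBasis A).mem_nhds_iff.1 hn
  have hx : x ∈ robustSet p V s C := fun b hb => (hVs hb).le
  filter_upwards [prod_mem_nhds ((ho V hV s).mem_nhds hx)
    ((TopologicalSpace.isBasis_countableBasis A).mem_nhds hV haV)] with q hq
  refine (ENNReal.toReal_lt_toReal hr' (measure_ne_top _ _)).1 (hs1.trans_le ?_)
  exact hq.1 q.2 hq.2

/-- Under (S), the kernel is weakly continuous for a topology whose basis is a countable algebra of
measurable sets stable under the formation of robust sets. -/
theorem SemiContinuousS.weaklyContinuous [TopologicalSpace X] [BorelSpace X]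
    [SecondCountableTopology A] {p : Kernel (X × A) X} [IsMarkovKernel p] (h : SemiContinuousS p)
    {𝒞 : Set (Set X)} (h𝒞 : IsSetAlgebra 𝒞) (hc : 𝒞.Countable) (hm : ∀ C ∈ 𝒞, MeasurableSet C)
    (hb : TopologicalSpace.IsTopologicalBasis 𝒞)
    (ho : ∀ C ∈ 𝒞, ∀ V ∈ TopologicalSpace.countableBasis A, ∀ s : ℚ, robustSet p V s C ∈ 𝒞) :
    WeaklyContinuous p := by
  have := hb.secondCountableTopology hc
  exact weaklyContinuous_of_lowerSemicontinuous h𝒞 hc hb fun C hC =>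
    h.lowerSemicontinuous (hm C hC) fun V hV s => hb.isOpen (ho C hC V hV s)

/-- Under (S), the topology of the state space can be refined, without changing the Borel sets, so
that the transition kernel becomes weakly continuous. -/
theorem SemiContinuousS.exists_weaklyContinuous [τ : TopologicalSpace X] [T2Space X]
    [SecondCountableTopology X] [hX : BorelSpace X] [SecondCountableTopology A]
    {p : Kernel (X × A) X} [IsMarkovKernel p] (h : SemiContinuousS p) :
    ∃ τ' : TopologicalSpace X, τ' ≤ τ ∧ @TopologicalSpace.MetrizableSpace X τ' ∧
      @SecondCountableTopology X τ' ∧ ∃ _ : @BorelSpace X τ' _,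
        @WeaklyContinuous (X × A) X (@instTopologicalSpaceProd X A τ' _) _ τ' _ _ p _ := by
  obtain ⟨𝒞, h0, hc, hm, halg, hF⟩ := exists_countable_isSetAlgebra
    (ι := TopologicalSpace.countableBasis A × ℚ) (fun i C => robustSet p i.1 i.2 C)
    (fun i C hC => h.measurableSet_robustSet
      (TopologicalSpace.isOpen_of_mem_countableBasis i.1.2) _ hC)
    (TopologicalSpace.countable_countableBasis X)
    (fun C hC => (TopologicalSpace.isOpen_of_mem_countableBasis hC).measurableSet)
  have hle : TopologicalSpace.generateFrom 𝒞 ≤ τ := by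
    rw [(TopologicalSpace.isBasis_countableBasis X).eq_generateFrom]
    exact TopologicalSpace.generateFrom_anti h0
  have hT : @T0Space X (TopologicalSpace.generateFrom 𝒞) := by
    have := t2Space_antitone hle inferInstance
    infer_instance
  have hb := @isTopologicalBasis_of_isSetAlgebra X (TopologicalSpace.generateFrom 𝒞) 𝒞 halg rfl
  have hsc := @TopologicalSpace.IsTopologicalBasis.secondCountableTopology X
    (TopologicalSpace.generateFrom 𝒞) 𝒞 hb hc
  have hB : @BorelSpace X (TopologicalSpace.generateFrom 𝒞) _ := by
    refine @BorelSpace.mk X (TopologicalSpace.generateFrom 𝒞) _ (le_antisymm ?_ ?_)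
    · rw [hX.measurable_eq]
      exact borel_anti hle
    · rw [@borel_eq_generateFrom_of_subbasis X 𝒞 (TopologicalSpace.generateFrom 𝒞) hsc rfl]
      exact MeasurableSpace.generateFrom_le hm
  refine ⟨TopologicalSpace.generateFrom 𝒞, hle, ?_, hsc, hB, ?_⟩
  · exact @metrizableSpace_of_isSetAlgebra X (.generateFrom 𝒞) hT 𝒞 halg hc hb
  · exact @SemiContinuousS.weaklyContinuous X A _ _ _ (.generateFrom 𝒞) hB _ p _ h 𝒞 halg hc hm hb
      fun C hC V hV s => hF (⟨V, hV⟩, s) C hC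

end Refinement

/-! ### Sequential compactness for semi-continuous models -/

section SemiContinuousModels

variable {X A : Type*} [MeasurableSpace X] [MeasurableSpace A]

/-- Weak convergence for a topology implies weak convergence for any coarser topology. -/
theorem tendsto_probabilityMeasure_mono {Ω ι : Type*} [MeasurableSpace Ω]
    {τ' : TopologicalSpace Ω} {hO : @OpensMeasurableSpace Ω τ' _} {τ : TopologicalSpace Ω}
    (hB : BorelSpace Ω) (hle : τ' ≤ τ) {L : Filter ι} {μs : ι → ProbabilityMeasure Ω}
    {μ : ProbabilityMeasure Ω}
    (h : Tendsto μs L (@nhds _ (@ProbabilityMeasure.instTopologicalSpace Ω _ τ' hO) μ)) :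
    Tendsto μs L (𝓝 μ) := by
  have := @ProbabilityMeasure.tendsto_map_of_tendsto_of_continuous Ω Ω _ _ τ' hO
    τ hB ι L μs μ h id (continuous_id_of_le hle)
  have hid : ∀ ν : ProbabilityMeasure Ω, ν.map (f := id) measurable_id.aemeasurable = ν :=
    fun ν => Subtype.ext Measure.map_id
  simpa only [hid] using this

theorem SemiContinuousW.weaklyContinuous [TopologicalSpace X] [OpensMeasurableSpace X]
    [TopologicalSpace A] {p : Kernel (X × A) X} [IsMarkovKernel p] (h : SemiContinuousW p) :
    WeaklyContinuous p :=
  ProbabilityMeasure.continuous_iff_forall_continuous_integral.2 fun f =>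
    h.continuous_integral f f.continuous ⟨‖f‖, fun y => f.norm_coe_le_norm y⟩

/-- In a semi-continuous model, every sequence of strategic measures has a subsequence that converges
to a strategic measure. -/
theorem SemiContinuous.exists_subseq_tendsto_strategicProba [TopologicalSpace X]
    [TopologicalBorelSpace X] [BorelSpace X] [TopologicalSpace A] [TopologicalBorelSpace A]
    [BorelSpace A] [Nonempty A] {p : Kernel (X × A) X} [IsMarkovKernel p] (h : SemiContinuous p)
    (P₀ : Measure X) [IsProbabilityMeasure P₀] (π : ℕ → Strategy X A) :
    ∃ (π' : Strategy X A) (φ : ℕ → ℕ), StrictMono φ ∧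
      Tendsto (fun n => strategicProba p P₀ (π (φ n))) atTop (𝓝 (strategicProba p P₀ π')) := by
  have := TopologicalBorelSpace.standardBorelSpace X
  have := TopologicalBorelSpace.standardBorelSpace A
  have hB : BorelSpace (Trajectory X A) := inferInstance
  rcases h with h | h
  · have := h.compactSpace
    obtain ⟨τ', hle, h1, h2, h3, h4⟩ := h.exists_weaklyContinuous
    obtain ⟨π', φ, hφ, ht⟩ := @MDP.exists_subseq_tendsto_strategicProba X A τ' h1 h2 _ h3
      _ _ _ _ _ _ _ _ p _ h4 P₀ _ π
    refine ⟨π', φ, hφ, tendsto_probabilityMeasure_mono hB ?_ ht⟩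
    exact iInf_mono fun _ => induced_mono (inf_le_inf_right _ (induced_mono hle))
  · have := h.compactSpace
    exact MDP.exists_subseq_tendsto_strategicProba h.weaklyContinuous P₀ π

end SemiContinuousModels

/-! ### Remainders and integrals of occupation measures -/

section Tail

variable {X A : Type*}

theorem lt_hittingTime_iff {z : X} {ω : Trajectory X A}
    (h : ∀ t, (ω t).1 = z → (ω (t + 1)).1 = z) (t : ℕ) :
    (t : ℕ∞) < hittingTime z ω ↔ (ω t).1 ≠ z := by
  refine ⟨fun ht hz => absurd ht (not_lt.2 (iInf₂_le (f := fun (t : ℕ) (_ : (ω t).1 = z) =>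
    (t : ℕ∞)) t hz)), fun ht => ?_⟩
  have hlt : ∀ s, (ω s).1 = z → t + 1 ≤ s := fun s hs => by
    by_contra! hst
    refine ht ?_
    induction t, Nat.lt_succ_iff.1 hst using Nat.le_induction with
    | base => exact hs
    | succ t hle ih =>
      exact h t (by_contra fun hne => hne (ih hne (Nat.lt_succ_of_le hle)))
  refine lt_of_lt_of_le (b := ((t + 1 : ℕ) : ℕ∞)) (by exact_mod_cast Nat.lt_succ_self t) ?_
  exact le_iInf₂ fun s hs => by exact_mod_cast hlt s hs

variable [MeasurableSpace X] [MeasurableSpace A]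

/-- The expected time spent off `z` from time `n` on, in terms of the laws of the states. Since `z` is
absorbing, `t < T₀` means `X_t ≠ z` almost surely. -/
theorem lintegral_tail_eq_tsum {p : Kernel (X × A) X} [IsMarkovKernel p] {P₀ : Measure X}
    [IsProbabilityMeasure P₀] {z : X} (hz : MeasurableSet ({z} : Set X))
    (habs : ∀ a : A, p (z, a) {z} = 1) (π : Strategy X A) (n : ℕ) :
    ∫⁻ ω, ∑' t : ℕ, (if n ≤ t ∧ (t : ℕ∞) < hittingTime z ω then (1 : ℝ≥0∞) else 0)
        ∂(strategicMeasure p P₀ π) =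
      ∑' t : ℕ, strategicMeasure p P₀ π {ω | (ω (t + n)).1 ≠ z} := by
  have hm : ∀ t : ℕ, MeasurableSet {ω : Trajectory X A | (ω t).1 ≠ z} := fun t =>
    hz.compl.preimage (f := fun ω : Trajectory X A => (ω t).1) (by fun_prop)
  calc _ = ∫⁻ ω, ∑' t : ℕ, {ω : Trajectory X A | (ω (t + n)).1 ≠ z}.indicator 1 ω
            ∂(strategicMeasure p P₀ π) := by
        refine lintegral_congr_ae ?_
        filter_upwards [ae_all_iff.2 fun t => ae_absorbed (P₀ := P₀) hz habs π t] with ω hω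
        rw [← ENNReal.summable.sum_add_tsum_nat_add' (k := n), Finset.sum_eq_zero, zero_add]
        · refine tsum_congr fun t => ?_
          have := lt_hittingTime_iff hω (t + n)
          by_cases h : (ω (t + n)).1 = z
          · rw [if_neg fun hlt => this.1 hlt.2 h, Set.indicator_of_notMem (by exact not_not.2 h)]
          · rw [if_pos ⟨Nat.le_add_left n t, this.2 h⟩, Set.indicator_of_mem (by exact h)]
            rfl
        · intro t ht
          simp [not_le.2 (Finset.mem_range.1 ht)]
    _ = ∑' t : ℕ, ∫⁻ ω, {ω : Trajectory X A | (ω (t + n)).1 ≠ z}.indicator 1 ω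
            ∂(strategicMeasure p P₀ π) :=
        lintegral_tsum fun t => (measurable_one.indicator (hm _)).aemeasurable
    _ = _ := tsum_congr fun t => lintegral_indicator_one (hm _)

end Tail

section Occupation

variable {X A : Type*} [MeasurableSpace X] [MeasurableSpace A]

theorem occupation_univ {z : X} (hz : MeasurableSet ({z} : Set X))
    (P : Measure (Trajectory X A)) :
    occupation z P Set.univ = ∑' t : ℕ, P {ω | (ω t).1 ≠ z} := by
  rw [occupation_apply hz _ MeasurableSet.univ]
  refine tsum_congr fun t => congrArg P (Set.ext fun ω => ⟨?_, fun hω => ?_⟩)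
  · rintro ⟨q, -, hq⟩
    have : (ω t).1 = q.1 := by rw [← hq]
    exact fun h => q.1.2 (this.symm.trans h)
  · exact ⟨(⟨(ω t).1, hω⟩, (ω t).2), trivial, rfl⟩

open Classical in
/-- The extension by zero to `X × A` of a function on `(X ∖ {z}) × A`. -/
noncomputable def extendByZero {X A : Type*} {z : X} (f : {x : X // x ≠ z} × A → NNReal)
    (q : X × A) : NNReal :=
  if h : q.1 ≠ z then f (⟨q.1, h⟩, q.2) else 0

theorem continuous_extendByZero {X A : Type*} [TopologicalSpace X] [T1Space X]
    [TopologicalSpace A] {z : X} (hz : IsOpen ({z} : Set X)) {f : {x : X // x ≠ z} × A → NNReal}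
    (hf : Continuous f) : Continuous (extendByZero f) := by
  have he : IsOpenEmbedding fun q : {x : X // x ≠ z} × A => ((q.1 : X), q.2) :=
    (isClosed_singleton.isOpen_compl.isOpenEmbedding_subtypeVal (X := X)).prodMap
      IsOpenEmbedding.id
  refine continuous_iff_continuousAt.2 fun q => ?_
  by_cases hq : q.1 = z
  · have : extendByZero f =ᶠ[𝓝 q] fun _ => 0 := by
      filter_upwards [(hz.preimage continuous_fst).mem_nhds hq] with q' hq'
      have : q'.1 = z := hq'
      simp [extendByZero, this]
    exact continuousAt_const.congr this.symm
  · have := (he.continuousAt_iff (g := extendByZero f) (x := (⟨q.1, hq⟩, q.2))).1 (by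
      refine hf.continuousAt.congr (Eventually.of_forall fun q' => ?_)
      simp [extendByZero, q'.1.2])
    exact this

theorem lintegral_occupation {z : X} (hz : MeasurableSet ({z} : Set X))
    (P : Measure (Trajectory X A)) {f : {x : X // x ≠ z} × A → NNReal}
    (hf : Measurable (extendByZero f)) :
    ∫⁻ q, f q ∂occupation z P = ∑' t : ℕ, ∫⁻ ω, extendByZero f (ω t) ∂P := by
  have he := measurableEmbedding_inclusion (A := A) hz
  rw [occupation, lintegral_sum_measure]
  refine tsum_congr fun t => ?_
  have h1 : ∀ q : {x : X // x ≠ z} × A, f q = extendByZero f ((q.1 : X), q.2) := fun q => by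
    simp [extendByZero, q.1.2]
  have hm : Measurable fun q => (extendByZero f q : ℝ≥0∞) := hf.coe_nnreal_ennreal
  simp only [h1]
  rw [← he.lintegral_map (fun q => (extendByZero f q : ℝ≥0∞)), he.map_comap,
    ← lintegral_indicator he.measurableSet_range, ← lintegral_map hm (measurable_pi_apply t)]
  refine lintegral_congr fun q => ?_
  refine Set.indicator_apply_eq_self.2 fun hq => ?_
  have : q.1 = z := by
    by_contra h
    exact hq ⟨(⟨q.1, h⟩, q.2), rfl⟩
  simp [extendByZero, this]

end Occupation

/-! ### Continuity of the projection and uniform absorption -/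

section Continuity

/-- A series of continuous functions with values in `[0, ∞]` whose remainders tend to zero uniformly
has a continuous sum. -/
theorem continuous_tsum_of_tail_le {T : Type*} [TopologicalSpace T] {g : ℕ → T → ℝ≥0∞}
    (hg : ∀ t, Continuous (g t)) {r : ℕ → ℝ≥0∞} (hr : Tendsto r atTop (𝓝 0))
    (hle : ∀ n x, ∑' t, g (t + n) x ≤ r n) : Continuous fun x => ∑' t, g t x := by
  have hc : ∀ n, Continuous fun x => ∑ t ∈ Finset.range n, g t x := fun n =>
    continuous_finsetSum _ fun t _ => hg t
  refine continuous_iff_continuousAt.2 fun x => tendsto_order.2 ⟨fun a ha => ?_, fun b hb => ?_⟩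
  · obtain ⟨n, hn⟩ := ((ENNReal.tendsto_nat_tsum fun t => g t x).eventually_const_lt ha).exists
    filter_upwards [(hc n).continuousAt.eventually_const_lt hn] with y hy
    exact hy.trans_le (ENNReal.sum_le_tsum _)
  · have h0 : Tendsto (fun n => ∑' t, g t x + r n) atTop (𝓝 (∑' t, g t x)) := by
      simpa using tendsto_const_nhds.add hr
    obtain ⟨n, hn⟩ := (h0.eventually_lt_const hb).exists
    have hn' : ∑ t ∈ Finset.range n, g t x + r n < b :=
      (add_le_add_left (ENNReal.sum_le_tsum _) _).trans_lt hn
    filter_upwards [((hc n).add continuous_const).continuousAt.eventually_lt_const hn'] with y hy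
    refine lt_of_le_of_lt ?_ hy
    rw [← ENNReal.summable.sum_add_tsum_nat_add' (k := n)]
    exact add_le_add_right (hle n y) _

variable {X A : Type*} [TopologicalSpace X] [TopologicalSpace.MetrizableSpace X]
  [SecondCountableTopology X] [MeasurableSpace X] [BorelSpace X]
  [TopologicalSpace A] [SecondCountableTopology A] [MeasurableSpace A] [BorelSpace A]
  {p : Kernel (X × A) X} [IsMarkovKernel p] {P₀ : Measure X} [IsProbabilityMeasure P₀] {z : X}

theorem IsUniformlyAbsorbing.continuous_projection (habs : IsAbsorbing p P₀ z)
    (h : IsUniformlyAbsorbing p P₀ z) : Continuous (projection habs) := by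
  have hz : MeasurableSet ({z} : Set X) := habs.isolated.measurableSet
  refine Continuous.subtype_mk
    (FiniteMeasure.continuous_iff_forall_continuous_lintegral.2 fun f => ?_) _
  have hf := continuous_extendByZero habs.isolated f.continuous
  change Continuous fun P : strategicMeasures p P₀ =>
    ∫⁻ q, f q ∂occupation z (P.1 : Measure (Trajectory X A))
  simp only [lintegral_occupation hz _ hf.measurable]
  obtain ⟨C, hC⟩ : ∃ C : NNReal, ∀ q, f q ≤ C :=
    ⟨_, fun q => BoundedContinuousFunction.NNReal.upper_bound f q⟩
  have hb : ∀ q : X × A, extendByZero f q ≤ C := fun q => by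
    unfold extendByZero
    split_ifs
    · exact hC _
    · exact zero_le
  refine continuous_tsum_of_tail_le (fun t => ?_)
    (ENNReal.Tendsto.const_mul (a := (C : ℝ≥0∞)) h.tendsto_zero (Or.inr ENNReal.coe_ne_top)
      |>.trans (by rw [mul_zero])) fun n P => ?_
  · let F : BoundedContinuousFunction (Trajectory X A) NNReal :=
      BoundedContinuousFunction.mkOfBound ⟨fun ω => extendByZero f (ω t), by fun_prop⟩ C
        fun ω ω' => by
          rw [NNReal.dist_eq, abs_sub_le_iff]
          constructor
          · have := hb (ω t)
            have h2 : (0 : ℝ) ≤ extendByZero f (ω' t) := NNReal.coe_nonneg _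
            have h3 : (extendByZero f (ω t) : ℝ) ≤ C := this
            simp only [ContinuousMap.coe_mk]; linarith
          · have := hb (ω' t)
            have h2 : (0 : ℝ) ≤ extendByZero f (ω t) := NNReal.coe_nonneg _
            have h3 : (extendByZero f (ω' t) : ℝ) ≤ C := this
            simp only [ContinuousMap.coe_mk]; linarith
    exact (ProbabilityMeasure.continuous_lintegral_boundedContinuousFunction F).comp
      continuous_subtype_val
  · obtain ⟨P, π, hπ⟩ := P
    simp only [hπ]
    refine le_trans ?_ (mul_le_mul_right (le_iSup (fun π : Strategy X A => ∫⁻ ω, ∑' t : ℕ,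
      (if n ≤ t ∧ (t : ℕ∞) < hittingTime z ω then (1 : ℝ≥0∞) else 0)
        ∂(strategicMeasure p P₀ π)) π) _)
    rw [lintegral_tail_eq_tsum hz habs.absorbing, ← ENNReal.tsum_mul_left]
    refine ENNReal.tsum_le_tsum fun t => ?_
    have hm : MeasurableSet {ω : Trajectory X A | (ω (t + n)).1 ≠ z} :=
      hz.compl.preimage (f := fun ω : Trajectory X A => (ω (t + n)).1) (by fun_prop)
    rw [← lintegral_indicator_const hm]
    refine lintegral_mono fun ω => ?_
    by_cases hω : (ω (t + n)).1 = z
    · simp [extendByZero, hω]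
    · rw [Set.indicator_of_mem (by exact hω)]
      exact ENNReal.coe_le_coe.2 (hb _)

/-- If strategic measures form a sequentially compact set and the projection is continuous, the model
is uniformly absorbing: mass `ε` lost to infinity in time along a convergent sequence would be a jump
of the total mass of the occupation measure. -/
theorem isUniformlyAbsorbing_of_continuous_projection [TopologicalSpace.MetrizableSpace A]
    (habs : IsAbsorbing p P₀ z)
    (hcomp : ∀ π : ℕ → Strategy X A, ∃ (π' : Strategy X A) (φ : ℕ → ℕ), StrictMono φ ∧
      Tendsto (fun n => strategicProba p P₀ (π (φ n))) atTop (𝓝 (strategicProba p P₀ π')))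
    (hc : Continuous (projection habs)) : IsUniformlyAbsorbing p P₀ z := by
  have hz : MeasurableSet ({z} : Set X) := habs.isolated.measurableSet
  refine ⟨habs, ?_⟩
  simp only [lintegral_tail_eq_tsum hz habs.absorbing]
  set u : Strategy X A → ℕ → ℝ≥0∞ := fun π t => strategicMeasure p P₀ π {ω | (ω t).1 ≠ z} with hu
  change Tendsto (fun n => ⨆ π, ∑' t, u π (t + n)) atTop (𝓝 0)
  rw [ENNReal.tendsto_atTop_zero]
  by_contra! hcon
  obtain ⟨ε, hε, hN⟩ := hcon
  -- The remainders decrease in `n`, so the failure for some `m ≥ n` gives a bad strategy for `n`.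
  have hex : ∀ n, ∃ π, ε < ∑' t, u π (t + n) := by
    intro n
    obtain ⟨m, hm, hlt⟩ := hN n
    obtain ⟨π, hπ⟩ := lt_iSup_iff.1 hlt
    refine ⟨π, hπ.trans_le ?_⟩
    obtain ⟨k, rfl⟩ := Nat.exists_eq_add_of_le hm
    refine (ENNReal.tsum_comp_le_tsum_of_injective (f := fun t : ℕ => t + k)
      (add_left_injective k) fun t => u π (t + n)).trans' (le_of_eq (tsum_congr fun t => ?_))
    rw [add_assoc, add_comm n k]
  choose π hπ using hex
  obtain ⟨π', φ, hφ, hlim⟩ := hcomp π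
  have hmass : Tendsto (fun n => ∑' t, u (π (φ n)) t) atTop (𝓝 (∑' t, u π' t)) := by
    have h1 : Tendsto (fun n => (⟨strategicProba p P₀ (π (φ n)), π (φ n), rfl⟩ :
        strategicMeasures p P₀)) atTop (𝓝 ⟨strategicProba p P₀ π', π', rfl⟩) :=
      tendsto_subtype_rng.2 hlim
    have h2 := ((FiniteMeasure.continuous_mass.comp continuous_subtype_val).comp hc).continuousAt
      |>.tendsto.comp h1
    have h3 := ENNReal.tendsto_coe.2 h2
    simp only [Function.comp_apply, FiniteMeasure.ennreal_mass] at h3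
    simp only [hu, ← occupation_univ hz]
    exact h3
  have hfin : ∑' t, u π' t ≠ ∞ := by
    have := isFiniteMeasure_occupationMeasure habs π'
    rw [← occupation_univ hz]
    exact measure_ne_top (occupationMeasure p P₀ z π') _
  have hut : ∀ t, Tendsto (fun n => u (π (φ n)) t) atTop (𝓝 (u π' t)) := fun t => by
    have := ENNReal.tendsto_coe.2 (ProbabilityMeasure.tendsto_measure_of_isClopen_of_tendsto hlim
      (IsClopen.preimage (s := ({z}ᶜ : Set X)) (f := fun ω : Trajectory X A => (ω t).1)
        ⟨habs.isolated.isClosed_compl, isClosed_singleton.isOpen_compl⟩ (by fun_prop)))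
    simp only [ProbabilityMeasure.ennreal_coeFn_eq_coeFn_toMeasure] at this
    exact this
  -- For `n ≥ m`, the mass `ε` after time `φ n` is not seen before time `m`.
  have hle : ∀ m, ∑ t ∈ Finset.range m, u π' t + ε ≤ ∑' t, u π' t := by
    intro m
    refine le_of_tendsto_of_tendsto
      ((tendsto_finsetSum _ fun t _ => hut t).add tendsto_const_nhds) hmass ?_
    filter_upwards [eventually_ge_atTop m] with n hn
    rw [← ENNReal.summable.sum_add_tsum_nat_add' (k := φ n)]
    refine add_le_add (Finset.sum_le_sum_of_subset ?_) (hπ (φ n)).le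
    exact Finset.range_subset_range.2 (hn.trans (hφ.id_le n))
  have hle' : ∑' t, u π' t + ε ≤ ∑' t, u π' t :=
    le_of_tendsto' ((ENNReal.tendsto_nat_tsum _).add tendsto_const_nhds) hle
  have : ∑' t, u π' t + ε ≤ ∑' t, u π' t + 0 := by rwa [add_zero]
  exact hε.ne' (le_zero_iff.1 ((ENNReal.add_le_add_iff_left hfin).1 this))

end Continuity

end MDP

theorem theorem2 {X : Type*} {A : Type*}
    [TopologicalSpace X] [MDP.TopologicalBorelSpace X] [MeasurableSpace X] [BorelSpace X]
    [TopologicalSpace A] [MDP.TopologicalBorelSpace A] [MeasurableSpace A] [BorelSpace A]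
    [Nonempty A]
    (p : Kernel (X × A) X) [IsMarkovKernel p]
    (P₀ : Measure X) [IsProbabilityMeasure P₀] (z : X)
    (hsc : MDP.SemiContinuous p) (habs : MDP.IsAbsorbing p P₀ z) :
    Continuous (MDP.projection habs) ↔ MDP.IsUniformlyAbsorbing p P₀ z :=
  ⟨MDP.isUniformlyAbsorbing_of_continuous_projection habs
      (hsc.exists_subseq_tendsto_strategicProba P₀),
    MDP.IsUniformlyAbsorbing.continuous_projection habs⟩
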